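/- Let $n\ge 1$ and write points of $\mathbb{R}^n=\mathbb{R}\times\mathbb{R}^{n-1}$ as $(x,y)$, with $v_0=(1,\mathbf 0)$. For a unit vector $v$ and $\Omega\subseteq\mathbb{R}^n$ let $\mathscr{P}_v(\Omega)=\{z: z\cdot v=0,\ z=p+sv \text{ for some } p\in\Omega,\ s\in\mathbb{R}\}$, and let $\mathscr{PW}(\Omega)=\inf_{v\in\mathbb{S}^{n-1}}\mathrm{diam}(\mathscr{P}_v(\Omega))$. Say that $\Omega$ is normalized with axial extent $d$ if $$\mathrm{diam}(\Omega)=2,\qquad \inf_{(x,y)\in\Omega}x=0,\qquad \sup_{(x,y)\in\Omega}x=d,\qquad \mathrm{diam}(\mathscr{P}_{v_0}(\Omega))=\mathscr{PW}(\Omega).$$ The $w$-diameter of $\Omega$ is the maximal $d>0$ such that some image of $\Omega$ under a rigid motion of $\mathbb{R}^n$ is normalized with axial extent $d$. There is a constant $C=C(n)>0$, depending only on $n$, such that the following holds. Let $\Omega\subseteq\mathbb{R}^n$ be a convex set with nonempty interior that is normalized with axial extent $d$, where $d$ is the $w$-diameter of $\Omega$. For $x\in\mathbb{R}$ let $\Omega_x=\{y\in\mathbb{R}^{n-1}:(x,y)\in\Omega\}$,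 let $h(x)$ be the $(n-1)$-dimensional volume of $\Omega_x$, and put $$\hat\epsilon=\sup_{t\in[0,d]}\mathrm{diam}(\Omega_t),\qquad \|x\|=\min\{x,d-x\}\quad (x\in[0,d]).$$ If $d\ge 2-10^{-6n}\,\hat\epsilon^2$, then $\frac{|h'|^2}{h}\|x\|^2$ is integrable on $[0,\frac1{10}]$ and $$\int_0^{1/10}\frac{|h'(x)|^2}{h(x)}\,\|x\|^2\,dx\ \ge\ C\cdot V(\Omega)\cdot\hat\epsilon^2,$$ where $V(\Omega)$ is the $n$-dimensional volume of $\Omega$. -/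

import Mathlib

open MeasureTheory Set

noncomputable section

namespace ConvexAxis

/-- The axis vector `v₀ = (1, 0, …, 0)` of `ℝⁿ = ℝ × ℝⁿ⁻¹`, where `n = m + 1`. -/
def axisVec (m : ℕ) : EuclideanSpace ℝ (Fin (m + 1)) :=
  EuclideanSpace.single 0 1

/-- The orthogonal projection of `Ω` to the hyperplane `v^⊥` (for a unit vector `v`):
all `x` with `x · v = 0` and `x = y + s v` for some `y ∈ Ω`, `s ∈ ℝ`. -/
def proj {m : ℕ} (v : EuclideanSpace ℝ (Fin (m + 1))) (Ω : Set (EuclideanSpace ℝ (Fin (m + 1)))) :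
    Set (EuclideanSpace ℝ (Fin (m + 1))) :=
  {x | inner ℝ x v = 0 ∧ ∃ y ∈ Ω, ∃ s : ℝ, x = y + s • v}

/-- The projective width of `Ω`: the least diameter of a projection of `Ω` along a unit vector. -/
def projWidth {m : ℕ} (Ω : Set (EuclideanSpace ℝ (Fin (m + 1)))) : ℝ :=
  ⨅ v : Metric.sphere (0 : EuclideanSpace ℝ (Fin (m + 1))) 1, Metric.diam (proj v.1 Ω)

/-- `Ω` is in normalized position with axial extent `d`: its diameter is `2`, its first
coordinate ranges exactly over an interval with end points `0` and `d`, and the projection along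
the first axis realizes the projective width. -/
structure IsNormalized {m : ℕ} (Ω : Set (EuclideanSpace ℝ (Fin (m + 1)))) (d : ℝ) : Prop where
  diam_eq : Metric.diam Ω = 2
  isGLB : IsGLB ((fun p : EuclideanSpace ℝ (Fin (m + 1)) => p 0) '' Ω) 0
  isLUB : IsLUB ((fun p : EuclideanSpace ℝ (Fin (m + 1)) => p 0) '' Ω) d
  proj_eq : Metric.diam (proj (axisVec m) Ω) = projWidth Ω

/-- `d` is the `w`-diameter of `Ω`: the largest positive axial extent of a normalized position
of `Ω` among all its images under rigid motions. -/
def IsWDiameter {m : ℕ} (Ω : Set (EuclideanSpace ℝ (Fin (m + 1)))) (d : ℝ) : Prop :=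
  IsGreatest {d' : ℝ | 0 < d' ∧
    ∃ φ : EuclideanSpace ℝ (Fin (m + 1)) ≃ᵢ EuclideanSpace ℝ (Fin (m + 1)),
      IsNormalized (φ '' Ω) d'} d

/-- The slice `Ω_x = {(x, y) ∈ Ω}`, regarded as a subset of `ℝⁿ⁻¹ = ℝᵐ`. -/
def slice {m : ℕ} (Ω : Set (EuclideanSpace ℝ (Fin (m + 1)))) (x : ℝ) :
    Set (EuclideanSpace ℝ (Fin m)) :=
  {y | WithLp.toLp 2 (Fin.cons x (fun i => y i) : Fin (m + 1) → ℝ) ∈ Ω}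

/-- `h(x)`, the `(n - 1)`-dimensional volume of the slice `Ω_x`. -/
def sliceVol {m : ℕ} (Ω : Set (EuclideanSpace ℝ (Fin (m + 1)))) (x : ℝ) : ℝ :=
  volume.real (slice Ω x)

/-- The maximal diameter of the slices `Ω_t`, `t ∈ [0, d]`. -/
def maxSliceDiam {m : ℕ} (Ω : Set (EuclideanSpace ℝ (Fin (m + 1)))) (d : ℝ) : ℝ :=
  sSup ((fun t : ℝ => Metric.diam (slice Ω t)) '' Icc 0 d)

/-- The "norm" `‖x‖ = min {x, d - x}` on `[0, d]`. -/
def axisNorm (d x : ℝ) : ℝ := min x (d - x)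

end ConvexAxis

end

namespace ConvexAxis

open Filter Topology

/-! Write `h` for `sliceVol Ω`, `ε` for `maxSliceDiam Ω d`, and `r = 10^{-3(m+1)} ε`, so that `d ≥ 2
- r²`. Since the diameter is `2`, Pythagoras against a point near the far end forces the slice at
`r²` to have diameter at most `7r`. Convexity gives the slice at `1/10` diameter at least `ε/50`,
which is far larger. Half-size copies of the thin slice, placed along a long segment of the wide
one, are disjoint and lie in the slice at the midpoint `y`, so `h y ≥ 2 h(r²)`
(`mul_sliceVol_le_midpoint`).

Hence `h` grows by at least `h y / 2` on `[r², y]`. Splitting `h' ≤ L (h'²/h) t² + h/(4 L t²)` and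
integrating bounds this growth by `L` times the weighted integral plus an error `M/(4 L r²)`, where
`M` bounds `h` (`sliceVol_sub_le_integral`). Cone comparison allows `M = 40^m h y`; then `L = 40^m /
r²` absorbs the error, and `V(Ω) ≤ 2M` turns `h y` into volume. The factor `r²` supplies `ε²`. -/

/-! ### Axial coordinates and slices. -/

/-- The point of `ℝ × ℝᵐ` with axial coordinate `x` and transversal coordinate `y`. -/
def axisPoint {m : ℕ} (x : ℝ) (y : EuclideanSpace ℝ (Fin m)) : EuclideanSpace ℝ (Fin (m + 1)) :=
  WithLp.toLp 2 (Fin.cons x (fun i => y i) : Fin (m + 1) → ℝ)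

/-- The transversal coordinate of a point. -/
def transversal {m : ℕ} (p : EuclideanSpace ℝ (Fin (m + 1))) : EuclideanSpace ℝ (Fin m) :=
  WithLp.toLp 2 (fun i => p i.succ)

theorem mem_slice {m : ℕ} {Ω : Set (EuclideanSpace ℝ (Fin (m + 1)))} {x : ℝ}
    {y : EuclideanSpace ℝ (Fin m)} : y ∈ slice Ω x ↔ axisPoint x y ∈ Ω := Iff.rfl

theorem axisPoint_transversal {m : ℕ} (p : EuclideanSpace ℝ (Fin (m + 1))) :
    axisPoint (p 0) (transversal p) = p := by
  ext i
  refine Fin.cases ?_ (fun j => ?_) i <;> rfl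

theorem transversal_mem_slice {m : ℕ} {Ω : Set (EuclideanSpace ℝ (Fin (m + 1)))}
    {p : EuclideanSpace ℝ (Fin (m + 1))} (hp : p ∈ Ω) : transversal p ∈ slice Ω (p 0) := by
  rwa [mem_slice, axisPoint_transversal]

theorem smul_axisPoint_add {m : ℕ} (a b x x' : ℝ) (y y' : EuclideanSpace ℝ (Fin m)) :
    a • axisPoint x y + b • axisPoint x' y' = axisPoint (a * x + b * x') (a • y + b • y') := by
  ext i
  refine Fin.cases ?_ (fun j => ?_) i <;> rfl

theorem dist_axisPoint_sq {m : ℕ} (x x' : ℝ) (y y' : EuclideanSpace ℝ (Fin m)) :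
    dist (axisPoint x y) (axisPoint x' y') ^ 2 = (x - x') ^ 2 + dist y y' ^ 2 := by
  rw [EuclideanSpace.dist_eq, EuclideanSpace.dist_eq, Real.sq_sqrt (by positivity),
    Real.sq_sqrt (by positivity), Fin.sum_univ_succ, Real.dist_eq, sq_abs]
  rfl

theorem combo_mem_slice {m : ℕ} {Ω : Set (EuclideanSpace ℝ (Fin (m + 1)))} (hc : Convex ℝ Ω)
    {a b x x' : ℝ} {y y' : EuclideanSpace ℝ (Fin m)} (ha : 0 ≤ a) (hb : 0 ≤ b) (hab : a + b = 1)
    (hy : y ∈ slice Ω x) (hy' : y' ∈ slice Ω x') :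
    a • y + b • y' ∈ slice Ω (a * x + b * x') := by
  rw [mem_slice, ← smul_axisPoint_add]
  exact hc hy hy' ha hb hab

theorem convex_slice {m : ℕ} {Ω : Set (EuclideanSpace ℝ (Fin (m + 1)))} (hc : Convex ℝ Ω) (x : ℝ) :
    Convex ℝ (slice Ω x) := by
  intro y hy y' hy' a b ha hb hab
  have h := combo_mem_slice hc ha hb hab hy hy'
  rwa [← add_mul, hab, one_mul] at h

/-- A bounded convex set whose axial coordinate ranges between `0` and `d`. -/
structure IsAxisBody {m : ℕ} (Ω : Set (EuclideanSpace ℝ (Fin (m + 1)))) (d : ℝ) : Prop where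
  convex : Convex ℝ Ω
  bounded : Bornology.IsBounded Ω
  isGLB : IsGLB ((fun p : EuclideanSpace ℝ (Fin (m + 1)) => p 0) '' Ω) 0
  isLUB : IsLUB ((fun p : EuclideanSpace ℝ (Fin (m + 1)) => p 0) '' Ω) d

namespace IsAxisBody

variable {m : ℕ} {Ω : Set (EuclideanSpace ℝ (Fin (m + 1)))} {d : ℝ}

theorem isBounded_slice (hΩ : IsAxisBody Ω d) (x : ℝ) : Bornology.IsBounded (slice Ω x) := by
  obtain ⟨C, hC⟩ := Metric.isBounded_iff.1 hΩ.bounded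
  refine Metric.isBounded_iff.2 ⟨C, fun y hy y' hy' => ?_⟩
  have h := hC (mem_slice.1 hy) (mem_slice.1 hy')
  have h2 := dist_axisPoint_sq x x y y'
  rw [sub_self, zero_pow two_ne_zero, zero_add] at h2
  rwa [← (pow_left_inj₀ dist_nonneg dist_nonneg two_ne_zero).1 h2]

theorem volume_slice_ne_top (hΩ : IsAxisBody Ω d) (x : ℝ) : volume (slice Ω x) ≠ ⊤ :=
  (hΩ.isBounded_slice x).measure_lt_top.ne

theorem mem_Icc_of_mem_slice (hΩ : IsAxisBody Ω d) {x : ℝ} {y : EuclideanSpace ℝ (Fin m)}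
    (hy : y ∈ slice Ω x) : x ∈ Icc 0 d :=
  ⟨hΩ.isGLB.1 ⟨_, hy, rfl⟩, hΩ.isLUB.1 ⟨_, hy, rfl⟩⟩

theorem sliceVol_eq_zero (hΩ : IsAxisBody Ω d) {x : ℝ} (hx : x ∉ Icc 0 d) : sliceVol Ω x = 0 := by
  have : slice Ω x = ∅ := eq_empty_of_forall_notMem fun y hy => hx (hΩ.mem_Icc_of_mem_slice hy)
  simp [sliceVol, this]

theorem exists_left (hΩ : IsAxisBody Ω d) {η : ℝ} (hη : 0 < η) :
    ∃ x, 0 ≤ x ∧ x < η ∧ (slice Ω x).Nonempty := by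
  obtain ⟨_, ⟨p, hp, rfl⟩, h0, h1⟩ := hΩ.isGLB.exists_between hη
  exact ⟨p 0, h0, h1, _, transversal_mem_slice hp⟩

theorem exists_right (hΩ : IsAxisBody Ω d) {η : ℝ} (hη : 0 < η) :
    ∃ x, d - η < x ∧ x ≤ d ∧ (slice Ω x).Nonempty := by
  obtain ⟨_, ⟨p, hp, rfl⟩, h0, h1⟩ := hΩ.isLUB.exists_between (sub_lt_self d hη)
  exact ⟨p 0, h0, h1, _, transversal_mem_slice hp⟩

/-! ### Cone comparison of slice volumes. -/

/-- The cone over the slice at `t` with apex in the slice at `x` lies in `Ω`, and its sections are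
homothetic copies of ratio `s`. -/
theorem pow_mul_sliceVol_le (hΩ : IsAxisBody Ω d) {x t s : ℝ} (hs0 : 0 ≤ s) (hs1 : s ≤ 1)
    (hx : (slice Ω x).Nonempty) :
    s ^ m * sliceVol Ω t ≤ sliceVol Ω ((1 - s) * x + s * t) := by
  obtain ⟨y, hy⟩ := hx
  have hsub : AffineMap.homothety y s '' slice Ω t ⊆ slice Ω ((1 - s) * x + s * t) := by
    rintro _ ⟨z, hz, rfl⟩
    have h := combo_mem_slice hΩ.convex (sub_nonneg.2 hs1) hs0 (sub_add_cancel 1 s) hy hz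
    convert h using 1
    rw [AffineMap.homothety_apply, vsub_eq_sub, vadd_eq_add, smul_sub, sub_smul, one_smul]
    abel
  have h := measureReal_mono hsub (hΩ.volume_slice_ne_top _) (μ := volume)
  rw [measureReal_def, Measure.addHaar_image_homothety, ENNReal.toReal_mul,
    ENNReal.toReal_ofReal (abs_nonneg _), finrank_euclideanSpace_fin,
    abs_of_nonneg (by positivity)] at h
  exact h

theorem sliceVol_nonneg (x : ℝ) : 0 ≤ sliceVol Ω x := measureReal_nonneg

/-- `Ω` need not be closed, so there may be no apex at height `0`; apexes at heights below `η` are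
used and `η → 0`. -/
theorem le_sliceVol_of_le (hΩ : IsAxisBody Ω d) {x t : ℝ} (hx : 0 < x) (hxt : x ≤ t) :
    (x / t) ^ m * sliceVol Ω t ≤ sliceVol Ω x := by
  have ht : 0 < t := hx.trans_le hxt
  have hlim : Tendsto (fun η : ℝ => ((x - η) / t) ^ m * sliceVol Ω t) (𝓝[>] 0)
      (𝓝 ((x / t) ^ m * sliceVol Ω t)) := by
    have : Continuous fun η : ℝ => ((x - η) / t) ^ m * sliceVol Ω t := by fun_prop
    simpa using (this.tendsto 0).mono_left nhdsWithin_le_nhds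
  refine le_of_tendsto hlim ?_
  filter_upwards [Ioo_mem_nhdsGT hx] with η hη
  obtain ⟨a, ha0, ha1, hne⟩ := hΩ.exists_left hη.1
  have hat : 0 < t - a := by linarith [hη.2]
  have h := hΩ.pow_mul_sliceVol_le (t := t) (s := (x - a) / (t - a))
    (div_nonneg (by linarith [hη.2]) hat.le) ((div_le_one hat).2 (by linarith)) hne
  have he : (1 - (x - a) / (t - a)) * a + (x - a) / (t - a) * t = x := by field_simp; ring
  rw [he] at h
  refine le_trans (mul_le_mul_of_nonneg_right (pow_le_pow_left₀ ?_ ?_ _) (sliceVol_nonneg _)) h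
  · exact div_nonneg (by linarith [hη.2]) ht.le
  · exact div_le_div₀ (by linarith [hη.2]) (by linarith) hat (by linarith)

theorem le_sliceVol_of_ge (hΩ : IsAxisBody Ω d) {x t : ℝ} (hx : x < d) (hxt : t ≤ x) :
    ((d - x) / (d - t)) ^ m * sliceVol Ω t ≤ sliceVol Ω x := by
  have ht : 0 < d - t := by linarith
  have hlim : Tendsto (fun η : ℝ => ((d - η - x) / (d - t)) ^ m * sliceVol Ω t) (𝓝[>] 0)
      (𝓝 (((d - x) / (d - t)) ^ m * sliceVol Ω t)) := by
    have : Continuous fun η : ℝ => ((d - η - x) / (d - t)) ^ m * sliceVol Ω t := by fun_prop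
    simpa using (this.tendsto 0).mono_left nhdsWithin_le_nhds
  refine le_of_tendsto hlim ?_
  filter_upwards [Ioo_mem_nhdsGT (sub_pos.2 hx)] with η hη
  obtain ⟨b, hb0, hb1, hne⟩ := hΩ.exists_right hη.1
  have hbt : 0 < b - t := by linarith [hη.2]
  have h := hΩ.pow_mul_sliceVol_le (t := t) (s := (b - x) / (b - t))
    (div_nonneg (by linarith [hη.2]) hbt.le) ((div_le_one hbt).2 (by linarith)) hne
  have he : (1 - (b - x) / (b - t)) * b + (b - x) / (b - t) * t = x := by field_simp; ring
  rw [he] at h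
  refine le_trans (mul_le_mul_of_nonneg_right (pow_le_pow_left₀ ?_ ?_ _) (sliceVol_nonneg _)) h
  · exact div_nonneg (by linarith [hη.2]) ht.le
  · exact div_le_div₀ (by linarith [hη.2]) (by linarith) hbt (by linarith)

/-! ### Lipschitz and derivative bounds for the slice volume. -/

/-- Bernoulli's inequality linearizes the factor `(a / b) ^ m` from the cone comparison. -/
theorem sliceVol_sub_le (hΩ : IsAxisBody Ω d) {a b : ℝ} (ha : 0 < a) (hab : a ≤ b) :
    sliceVol Ω b - sliceVol Ω a ≤ m * (b - a) / b * sliceVol Ω b := by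
  have hb : 0 < b := ha.trans_le hab
  have h := hΩ.le_sliceVol_of_le ha hab
  have hB := one_add_mul_le_pow (a := -((b - a) / b))
    (by have : (b - a) / b ≤ 1 := (div_le_one hb).2 (by linarith)
        linarith) m
  have he : 1 + -((b - a) / b) = a / b := by field_simp; ring
  rw [he] at hB
  have := mul_le_mul_of_nonneg_right hB (sliceVol_nonneg (Ω := Ω) b)
  rw [mul_div_assoc]
  linarith

theorem sub_sliceVol_le (hΩ : IsAxisBody Ω d) {a b : ℝ} (hab : a ≤ b) (hb : b < d) :
    sliceVol Ω a - sliceVol Ω b ≤ m * (b - a) / (d - a) * sliceVol Ω a := by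
  have hd : 0 < d - a := by linarith
  have h := hΩ.le_sliceVol_of_ge hb hab
  have hB := one_add_mul_le_pow (a := -((b - a) / (d - a)))
    (by have : (b - a) / (d - a) ≤ 1 := (div_le_one hd).2 (by linarith)
        linarith) m
  have he : 1 + -((b - a) / (d - a)) = (d - b) / (d - a) := by field_simp; ring
  rw [he] at hB
  have := mul_le_mul_of_nonneg_right hB (sliceVol_nonneg (Ω := Ω) a)
  rw [mul_div_assoc]
  linarith

theorem lipschitzOnWith_sliceVol (hΩ : IsAxisBody Ω d) {α β M : ℝ} (hα : 0 < α) (hβ : β < d)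
    (hM : ∀ t, sliceVol Ω t ≤ M) :
    ∃ K, LipschitzOnWith K (sliceVol Ω) (Icc α β) := by
  have hM0 : 0 ≤ M := (sliceVol_nonneg 0).trans (hM 0)
  have hβ' : 0 < d - β := sub_pos.2 hβ
  have key : ∀ a ∈ Icc α β, ∀ b ∈ Icc α β, a ≤ b →
      |sliceVol Ω a - sliceVol Ω b| ≤ m * M * (1 / α + 1 / (d - β)) * |a - b| := by
    intro a ha b hb hab
    have h1 := hΩ.sliceVol_sub_le (hα.trans_le ha.1) hab
    have h2 := hΩ.sub_sliceVol_le hab (hb.2.trans_lt hβ)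
    have hb0 : 0 ≤ b - a := sub_nonneg.2 hab
    have h3 : m * (b - a) / b * sliceVol Ω b ≤ m * (b - a) / α * M :=
      mul_le_mul (div_le_div_of_nonneg_left (by positivity) hα hb.1) (hM b)
        (sliceVol_nonneg _) (by positivity)
    have h4 : m * (b - a) / (d - a) * sliceVol Ω a ≤ m * (b - a) / (d - β) * M :=
      mul_le_mul (div_le_div_of_nonneg_left (by positivity) hβ' (by linarith [ha.2])) (hM a)
        (sliceVol_nonneg _) (by positivity)
    have h5 : 0 ≤ m * (b - a) / α * M := by positivity
    have h6 : 0 ≤ m * (b - a) / (d - β) * M := by positivity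
    have he : m * M * (1 / α + 1 / (d - β)) * |a - b|
        = m * (b - a) / α * M + m * (b - a) / (d - β) * M := by
      rw [abs_sub_comm, abs_of_nonneg hb0]; ring
    rw [he, abs_le]
    constructor <;> linarith
  refine ⟨(m * M * (1 / α + 1 / (d - β))).toNNReal, LipschitzOnWith.of_dist_le_mul ?_⟩
  intro a ha b hb
  rw [Real.coe_toNNReal _ (by positivity), Real.dist_eq, Real.dist_eq]
  rcases le_total a b with hab | hab
  · exact key a ha b hb hab
  · rw [abs_sub_comm, abs_sub_comm a b]
    exact key b hb a ha hab

/-- Left slopes are bounded above through cones with apex near `0`, right slopes below through cones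
with apex near `d`; `x ≤ d - x` makes `1 / x` the weaker of the two rates. -/
theorem abs_deriv_sliceVol_le (hΩ : IsAxisBody Ω d) {x : ℝ} (hx : 0 < x) (hxd : x ≤ d - x) :
    |deriv (sliceVol Ω) x| ≤ m * sliceVol Ω x / x := by
  -- Where the slice volume is not differentiable, `deriv` takes the value `0` and the bound is
  -- trivial.
  by_cases hdiff : DifferentiableAt ℝ (sliceVol Ω) x
  swap
  · rw [deriv_zero_of_not_differentiableAt hdiff, abs_zero]
    have := sliceVol_nonneg (Ω := Ω) x
    positivity
  have hslope := hasDerivAt_iff_tendsto_slope.1 hdiff.hasDerivAt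
  rw [abs_le]
  constructor
  · refine ge_of_tendsto (hslope.mono_left (nhdsGT_le_nhdsNE x)) ?_
    filter_upwards [Ioo_mem_nhdsGT (show x < d by linarith)] with b hb
    have hb0 : 0 < b - x := sub_pos.2 hb.1
    have h := hΩ.sub_sliceVol_le hb.1.le hb.2
    have h2 : m * (b - x) / (d - x) * sliceVol Ω x ≤ m * (b - x) / x * sliceVol Ω x :=
      mul_le_mul_of_nonneg_right (div_le_div_of_nonneg_left (by positivity) hx hxd)
        (sliceVol_nonneg _)
    rw [slope_def_field, le_div_iff₀ hb0]
    have he : m * (b - x) / x * sliceVol Ω x = m * sliceVol Ω x / x * (b - x) := by ring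
    linarith
  · refine le_of_tendsto (hslope.mono_left (nhdsLT_le_nhdsNE x)) ?_
    filter_upwards [Ioo_mem_nhdsLT hx] with a ha
    have ha0 : 0 < x - a := sub_pos.2 ha.2
    have h := hΩ.sliceVol_sub_le ha.1 ha.2.le
    rw [slope_comm, slope_def_field, div_le_iff₀ ha0]
    have he : m * (x - a) / x * sliceVol Ω x = m * sliceVol Ω x / x * (x - a) := by ring
    linarith

/-! ### Bounding all slices and the total volume by one slice. -/

theorem sliceVol_le_of_mem_Icc (hΩ : IsAxisBody Ω d) (hd1 : 1 ≤ d) (hd2 : d ≤ 2) {y : ℝ}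
    (hy1 : 1 / 20 ≤ y) (hy2 : y ≤ 1 / 10) (t : ℝ) : sliceVol Ω t ≤ 40 ^ m * sliceVol Ω y := by
  by_cases ht : t ∈ Icc 0 d
  swap
  · rw [hΩ.sliceVol_eq_zero ht]
    have := sliceVol_nonneg (Ω := Ω) y
    positivity
  -- The worst cone ratio is `y / t ≥ (1/20) / 2`.
  have key : ∀ r : ℝ, 1 / 40 ≤ r → r ^ m * sliceVol Ω t ≤ sliceVol Ω y →
      sliceVol Ω t ≤ 40 ^ m * sliceVol Ω y := by
    intro r hr h
    have h1 : (1 / 40 : ℝ) ^ m * sliceVol Ω t ≤ sliceVol Ω y :=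
      (mul_le_mul_of_nonneg_right (pow_le_pow_left₀ (by norm_num) hr m) (sliceVol_nonneg t)).trans h
    rwa [one_div, inv_pow, inv_mul_le_iff₀ (by positivity)] at h1
  rcases le_total y t with h | h
  · refine key _ ?_ (hΩ.le_sliceVol_of_le (by linarith) h)
    rw [le_div_iff₀ (by linarith)]
    linarith [ht.2]
  · refine key _ ?_ (hΩ.le_sliceVol_of_ge (by linarith) h)
    rw [le_div_iff₀ (by linarith)]
    linarith [ht.1]

theorem volume_le (hΩ : IsAxisBody Ω d) (hd : 0 ≤ d) {M : ℝ} (hM : ∀ t, sliceVol Ω t ≤ M) :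
    volume.real Ω ≤ d * M := by
  have hM0 : 0 ≤ M := (sliceVol_nonneg 0).trans (hM 0)
  -- `Ω` need not be Borel; its frontier is null by convexity, so Fubini is applied to the interior.
  have hint : volume Ω = volume (interior Ω) := by
    refine le_antisymm ?_ (measure_mono interior_subset)
    calc volume Ω ≤ volume (interior Ω ∪ frontier Ω) :=
          measure_mono (by rw [← closure_eq_interior_union_frontier]; exact subset_closure)
      _ ≤ volume (interior Ω) + volume (frontier Ω) := measure_union_le _ _
      _ = volume (interior Ω) := by rw [hΩ.convex.addHaar_frontier volume, add_zero]
  let e := MeasurableEquiv.piFinSuccAbove (fun _ : Fin (m + 1) => ℝ) 0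
  have he : MeasurePreserving e.symm :=
    (volume_preserving_piFinSuccAbove (fun _ : Fin (m + 1) => ℝ) 0).symm
  have hmp := (PiLp.volume_preserving_toLp (Fin (m + 1))).comp he
  have hmeas : MeasurableSet (interior Ω) := isOpen_interior.measurableSet
  have hle : volume (interior Ω) ≤ ENNReal.ofReal (d * M) := by
    rw [← hmp.measure_preimage hmeas.nullMeasurableSet, Measure.volume_eq_prod,
      Measure.prod_apply (hmp.measurable hmeas)]
    have hpt : ∀ x : ℝ, volume (Prod.mk x ⁻¹' (WithLp.toLp 2 ∘ e.symm ⁻¹' interior Ω))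
        ≤ (Icc 0 d).indicator (fun _ => ENNReal.ofReal M) x := by
      intro x
      have hsub : Prod.mk x ⁻¹' (WithLp.toLp 2 ∘ e.symm ⁻¹' interior Ω)
          ⊆ WithLp.toLp 2 ⁻¹' slice Ω x := by
        intro y hy
        have h1 : WithLp.toLp 2 (e.symm (x, y)) ∈ Ω := interior_subset hy
        rw [mem_preimage, mem_slice]
        convert h1 using 1
        ext i
        refine Fin.cases ?_ (fun j => ?_) i <;> simp [e, axisPoint]
      by_cases hx : x ∈ Icc 0 d
      · rw [indicator_of_mem hx]
        refine (measure_mono hsub).trans ?_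
        rw [(PiLp.volume_preserving_toLp (Fin m)).measure_preimage
          ((convex_slice hΩ.convex x).nullMeasurableSet volume)]
        rw [← ENNReal.ofReal_toReal (hΩ.volume_slice_ne_top x)]
        exact ENNReal.ofReal_le_ofReal (hM x)
      · rw [indicator_of_notMem hx]
        refine le_of_eq (measure_mono_null hsub ?_)
        have : slice Ω x = ∅ :=
          eq_empty_of_forall_notMem fun y hy => hx (hΩ.mem_Icc_of_mem_slice hy)
        rw [this, preimage_empty, measure_empty]
    refine (lintegral_mono hpt).trans ?_
    rw [lintegral_indicator measurableSet_Icc, lintegral_const, Measure.restrict_apply_univ,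
      Real.volume_Icc, sub_zero, mul_comm, ENNReal.ofReal_mul hd]
  rw [measureReal_def, hint]
  exact ENNReal.toReal_le_of_le_ofReal (by positivity) hle

/-! ### Thin and wide slices near the end. -/

/-- If one slice is much smaller in diameter than another one, then many disjoint half-size
translates of it fit into the slice half-way between the two. -/
theorem mul_sliceVol_le_midpoint (hΩ : IsAxisBody Ω d) {x x' δ : ℝ} {N : ℕ}
    (hδ : ∀ y ∈ slice Ω x, ∀ y' ∈ slice Ω x, dist y y' ≤ δ) {b b' : EuclideanSpace ℝ (Fin m)}
    (hb : b ∈ slice Ω x') (hb' : b' ∈ slice Ω x') (hN : N * δ < dist b b') :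
    N * sliceVol Ω x ≤ 2 ^ m * sliceVol Ω ((x + x') / 2) := by
  rcases Nat.eq_zero_or_pos N with rfl | hN0
  · have := sliceVol_nonneg (Ω := Ω) ((x + x') / 2)
    rw [Nat.cast_zero, zero_mul]
    positivity
  have hN0' : (0 : ℝ) < N := Nat.cast_pos.2 hN0
  let c : ℕ → EuclideanSpace ℝ (Fin m) := fun j => AffineMap.lineMap b b' ((j : ℝ) / N)
  let F : ℕ → Set (EuclideanSpace ℝ (Fin m)) :=
    fun j => AffineMap.homothety (c j) (1 / 2 : ℝ) '' slice Ω x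
  have hc : ∀ j ∈ Finset.range N, c j ∈ slice Ω x' := by
    intro j hj
    refine (convex_slice hΩ.convex x').lineMap_mem hb hb' ⟨by positivity, ?_⟩
    rw [div_le_one hN0']
    exact_mod_cast (Finset.mem_range.1 hj).le
  have hform : ∀ j z, AffineMap.homothety (c j) (1 / 2 : ℝ) z
      = (1 / 2 : ℝ) • z + (1 / 2 : ℝ) • c j := by
    intro j z
    rw [AffineMap.homothety_apply, vsub_eq_sub, vadd_eq_add]
    module
  have hsub : ∀ j ∈ Finset.range N, F j ⊆ slice Ω ((x + x') / 2) := by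
    rintro j hj _ ⟨z, hz, rfl⟩
    have h := combo_mem_slice hΩ.convex (by norm_num : (0 : ℝ) ≤ 1 / 2)
      (by norm_num : (0 : ℝ) ≤ 1 / 2) (by norm_num) hz (hc j hj)
    rw [hform]
    convert h using 2
    ring
  -- A common point would make the difference of two centres a difference of two points of the thin
  -- slice, but distinct centres are at least `dist b b' / N > δ` apart.
  have hdisj : ∀ i j : ℕ, i ≠ j → Disjoint (F i) (F j) := by
    intro i j hij
    rw [Set.disjoint_left]
    rintro _ ⟨z, hz, rfl⟩ ⟨w, hw, hwz⟩
    rw [hform, hform] at hwz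
    have h1 : w - z = c i - c j := by
      have h2 : (1 / 2 : ℝ) • (w - z) = (1 / 2 : ℝ) • (c i - c j) := by
        rw [smul_sub, smul_sub, sub_eq_sub_iff_add_eq_add, hwz, add_comm]
      exact smul_right_injective _ (by norm_num : (1 / 2 : ℝ) ≠ 0) h2
    have h3 : dist (c i) (c j) ≤ δ := by
      rw [dist_eq_norm, ← h1, ← dist_eq_norm]
      exact hδ w hw z hz
    have h4 : dist (c i) (c j) = |(i : ℝ) - j| / N * dist b b' := by
      rw [dist_lineMap_lineMap, Real.dist_eq, ← sub_div, abs_div, abs_of_pos hN0']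
    have h5 : (1 : ℝ) ≤ |(i : ℝ) - j| := by
      have : (1 : ℤ) ≤ |(i : ℤ) - j| := Int.one_le_abs (sub_ne_zero.2 (by exact_mod_cast hij))
      exact_mod_cast this
    have h6 : 1 / N * dist b b' ≤ dist (c i) (c j) := by
      rw [h4]
      gcongr
    have h7 : dist b b' ≤ N * dist (c i) (c j) := by
      rwa [one_div, inv_mul_le_iff₀ hN0'] at h6
    have h8 := mul_le_mul_of_nonneg_left h3 hN0'.le
    linarith
  have hvol : ∀ j, volume (F j) = ENNReal.ofReal ((1 / 2) ^ m) * volume (slice Ω x) := by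
    intro j
    rw [Measure.addHaar_image_homothety, finrank_euclideanSpace_fin, abs_of_nonneg (by positivity)]
  have hnull : ∀ j, NullMeasurableSet (F j) volume := fun j =>
    ((convex_slice hΩ.convex x).affine_image (AffineMap.homothety (c j) (1 / 2))).nullMeasurableSet
      volume
  have hsum : volume (⋃ j ∈ Finset.range N, F j)
      = N * (ENNReal.ofReal ((1 / 2) ^ m) * volume (slice Ω x)) := by
    rw [measure_biUnion_finset₀ (fun i _ j _ hij => (hdisj i j hij).aedisjoint)
      (fun j _ => hnull j)]
    simp only [hvol, Finset.sum_const, Finset.card_range, nsmul_eq_mul]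
  have h := measureReal_mono (iUnion₂_subset hsub) (hΩ.volume_slice_ne_top _) (μ := volume)
  rw [measureReal_def, hsum, ENNReal.toReal_mul, ENNReal.toReal_mul, ENNReal.toReal_natCast,
    ENNReal.toReal_ofReal (by positivity), one_div, inv_pow] at h
  change N * ((2 ^ m)⁻¹ * sliceVol Ω x) ≤ sliceVol Ω ((x + x') / 2) at h
  rwa [mul_left_comm, inv_mul_le_iff₀ (by positivity)] at h

/-- A fixed point `z` near the far end is at axial distance at least `2 - 3r²`, leaving transversal
distance squared at most `4 - (2 - 3r²)² ≤ 12r² ≤ (7r/2)²`. -/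
theorem dist_le_of_mem_slice (hΩ : IsAxisBody Ω d) (hdist : ∀ p ∈ Ω, ∀ q ∈ Ω, dist p q ≤ 2)
    {r : ℝ} (hr : 0 < r) (hr1 : r ≤ 1 / 10) (hd : 2 - r ^ 2 ≤ d) :
    ∀ y ∈ slice Ω (r ^ 2), ∀ y' ∈ slice Ω (r ^ 2), dist y y' ≤ 7 * r := by
  obtain ⟨b, hb0, -, z, hz⟩ := hΩ.exists_right (pow_pos hr 2)
  have key : ∀ y ∈ slice Ω (r ^ 2), dist y z ≤ 7 / 2 * r := by
    intro y hy
    have h1 := hdist _ (mem_slice.1 hy) _ (mem_slice.1 hz)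
    have h2 := dist_axisPoint_sq (r ^ 2) b y z
    have h3 : dist (axisPoint (r ^ 2) y) (axisPoint b z) ^ 2 ≤ 2 ^ 2 :=
      pow_le_pow_left₀ dist_nonneg h1 2
    have h4 : r ^ 2 ≤ (1 / 10) ^ 2 := pow_le_pow_left₀ hr.le hr1 2
    have h5 : (2 - 3 * r ^ 2) ^ 2 ≤ (b - r ^ 2) ^ 2 :=
      pow_le_pow_left₀ (by linarith) (by linarith) 2
    refine le_of_sq_le_sq ?_ (by positivity)
    nlinarith [sq_nonneg r]
  intro y hy y' hy'
  have h := dist_triangle_right y y' z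
  linarith [key y hy, key y' hy']

theorem exists_dist_eq_mul (hΩ : IsAxisBody Ω d) {a t x s : ℝ} (hs0 : 0 ≤ s) (hs1 : s ≤ 1)
    (ha : (slice Ω a).Nonempty) (hx : (1 - s) * a + s * t = x)
    {y y' : EuclideanSpace ℝ (Fin m)} (hy : y ∈ slice Ω t) (hy' : y' ∈ slice Ω t) :
    ∃ b ∈ slice Ω x, ∃ b' ∈ slice Ω x, dist b b' = s * dist y y' := by
  obtain ⟨z, hz⟩ := ha
  have h := fun w hw => combo_mem_slice hΩ.convex (sub_nonneg.2 hs1) hs0 (sub_add_cancel 1 s) hz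
    (y' := w) (x' := t) hw
  rw [hx] at h
  refine ⟨_, h y hy, _, h y' hy', ?_⟩
  rw [dist_add_left, dist_smul₀, Real.norm_of_nonneg hs0]

/-- A slice of nearly maximal diameter is shrunk to height `1/10` by a cone whose apex is near
whichever end lies on the other side of `1/10`. -/
theorem exists_dist_slice (hΩ : IsAxisBody Ω d) (hd1 : 19 / 10 ≤ d) (hd2 : d ≤ 2)
    (hε : 0 < maxSliceDiam Ω d) :
    ∃ b ∈ slice Ω (1 / 10), ∃ b' ∈ slice Ω (1 / 10), maxSliceDiam Ω d / 50 ≤ dist b b' := by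
  set ε := maxSliceDiam Ω d with hεdef
  obtain ⟨_, ⟨t, ht, rfl⟩, htε⟩ := exists_lt_of_lt_csSup
    (Set.Nonempty.image _ (nonempty_Icc.2 (by linarith))) (half_lt_self hε)
  have : ∃ y ∈ slice Ω t, ∃ y' ∈ slice Ω t, ε / 2 < dist y y' := by
    by_contra! hcon
    exact absurd (Metric.diam_le_of_forall_dist_le (by positivity) hcon) (not_le.2 htε)
  obtain ⟨y, hy, y', hy', hyy⟩ := this
  -- The critical ratio is `(1/10 - 1/100) / (2 - 1/100) ≥ 9/200`; half of it, times `ε`, still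
  -- exceeds `ε / 50`.
  have hmain : ∃ s : ℝ, 9 / 200 ≤ s ∧ s ≤ 1 ∧ ∃ a, (slice Ω a).Nonempty ∧
      (1 - s) * a + s * t = 1 / 10 := by
    rcases le_total (1 / 10) t with h | h
    · obtain ⟨a, ha0, ha1, hne⟩ := hΩ.exists_left (show (0 : ℝ) < 1 / 100 by norm_num)
      have hta : 0 < t - a := by linarith
      refine ⟨(1 / 10 - a) / (t - a), ?_, (div_le_one hta).2 (by linarith), a, hne, ?_⟩
      · rw [le_div_iff₀ hta]
        linarith [ht.2]
      · field_simp
        ring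
    · obtain ⟨a, ha0, ha1, hne⟩ := hΩ.exists_right (show (0 : ℝ) < 1 / 2 by norm_num)
      have hta : 0 < a - t := by linarith
      refine ⟨(a - 1 / 10) / (a - t), ?_, (div_le_one hta).2 (by linarith), a, hne, ?_⟩
      · rw [le_div_iff₀ hta]
        linarith [ht.1]
      · field_simp
        ring
  obtain ⟨s, hs0, hs1, a, hne, he⟩ := hmain
  obtain ⟨b, hb, b', hb', hbb⟩ :=
    hΩ.exists_dist_eq_mul (by linarith) hs1 hne he hy hy'
  refine ⟨b, hb, b', hb', ?_⟩
  rw [hbb]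
  nlinarith

theorem maxSliceDiam_le (hdist : ∀ p ∈ Ω, ∀ q ∈ Ω, dist p q ≤ 2) :
    maxSliceDiam Ω d ≤ 2 := by
  refine Real.sSup_le ?_ (by norm_num)
  rintro _ ⟨t, -, rfl⟩
  refine Metric.diam_le_of_forall_dist_le (by norm_num) fun y hy y' hy' => ?_
  have h := hdist _ (mem_slice.1 hy) _ (mem_slice.1 hy')
  have h2 := dist_axisPoint_sq t t y y'
  rw [sub_self, zero_pow two_ne_zero, zero_add] at h2
  rwa [← (pow_left_inj₀ dist_nonneg dist_nonneg two_ne_zero).1 h2]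

/-! ### The weighted integral and the growth it controls. -/

theorem sliceVol_pos (hΩ : IsAxisBody Ω d) (hne : (interior Ω).Nonempty) {x : ℝ} (hx : x ∈ Ioo 0 d) :
    0 < sliceVol Ω x := by
  obtain ⟨p, hp⟩ := hne
  have hcont : Continuous fun y : EuclideanSpace ℝ (Fin m) => axisPoint (p 0) y := by
    refine (PiLp.continuous_toLp 2 _).comp (continuous_pi fun i => ?_)
    refine Fin.cases ?_ (fun j => ?_) i
    · exact continuous_const
    · simp only [Fin.cons_succ]
      fun_prop
  have hopen : IsOpen ((fun y : EuclideanSpace ℝ (Fin m) => axisPoint (p 0) y) ⁻¹' interior Ω) :=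
    isOpen_interior.preimage hcont
  have hpos : 0 < sliceVol Ω (p 0) := by
    refine ENNReal.toReal_pos (ne_of_gt ?_) (hΩ.volume_slice_ne_top _)
    refine lt_of_lt_of_le (hopen.measure_pos volume ⟨transversal p, ?_⟩)
      (measure_mono fun y hy => mem_slice.2 (interior_subset (s := Ω) hy))
    rwa [mem_preimage, axisPoint_transversal]
  have hp0 := hΩ.mem_Icc_of_mem_slice (transversal_mem_slice (interior_subset hp))
  rcases le_total x (p 0) with h | h
  · refine lt_of_lt_of_le ?_ (hΩ.le_sliceVol_of_le hx.1 h)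
    have := hx.1.trans_le h
    have := hx.1
    positivity
  · refine lt_of_lt_of_le ?_ (hΩ.le_sliceVol_of_ge hx.2 h)
    have h1 := sub_pos.2 hx.2
    have h2 : 0 < d - p 0 := by linarith
    positivity

theorem integrand_le (hΩ : IsAxisBody Ω d) (hne : (interior Ω).Nonempty) (hd1 : 19 / 10 ≤ d)
    {x : ℝ} (hx : x ∈ Ioc (0 : ℝ) (1 / 10)) :
    |deriv (sliceVol Ω) x| ^ 2 / sliceVol Ω x * axisNorm d x ^ 2 ≤ m ^ 2 * sliceVol Ω x := by
  have hpos := hΩ.sliceVol_pos hne (x := x) ⟨hx.1, by linarith [hx.2]⟩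
  have hx0 := hx.1
  rw [axisNorm, min_eq_left (by linarith [hx.2])]
  have h := hΩ.abs_deriv_sliceVol_le hx.1 (by linarith [hx.2])
  rw [le_div_iff₀ hx.1] at h
  have h2 := pow_le_pow_left₀ (by positivity) h 2
  rw [div_mul_eq_mul_div, div_le_iff₀ hpos]
  nlinarith

theorem integrand_nonneg (x : ℝ) :
    0 ≤ |deriv (sliceVol Ω) x| ^ 2 / sliceVol Ω x * axisNorm d x ^ 2 := by
  have := sliceVol_nonneg (Ω := Ω) x
  positivity

theorem intervalIntegrable_integrand (hΩ : IsAxisBody Ω d) (hne : (interior Ω).Nonempty)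
    (hd1 : 19 / 10 ≤ d) {M : ℝ} (hM : ∀ t, sliceVol Ω t ≤ M) :
    IntervalIntegrable
      (fun x : ℝ => |deriv (sliceVol Ω) x| ^ 2 / sliceVol Ω x * axisNorm d x ^ 2)
      volume 0 (1 / 10) := by
  have hcont : ContinuousOn (sliceVol Ω) (Ioc 0 (1 / 10)) := by
    intro x hx
    obtain ⟨K, hK⟩ := hΩ.lipschitzOnWith_sliceVol (half_pos hx.1)
      (show (1 / 10 : ℝ) < d by linarith) hM
    refine (hK.continuousOn x ⟨(half_lt_self hx.1).le, hx.2⟩).mono_of_mem_nhdsWithin ?_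
    filter_upwards [self_mem_nhdsWithin, mem_nhdsWithin_of_mem_nhds
      (Ioi_mem_nhds (half_lt_self hx.1))] with z hz hz'
    exact ⟨le_of_lt hz', hz.2⟩
  have hmeas : AEStronglyMeasurable (sliceVol Ω) (volume.restrict (Ioc 0 (1 / 10))) :=
    hcont.aestronglyMeasurable measurableSet_Ioc
  have hax : Measurable (axisNorm d) := by
    unfold axisNorm
    fun_prop
  have hderiv : Measurable (deriv (sliceVol Ω)) := measurable_deriv _
  rw [intervalIntegrable_iff_integrableOn_Ioc_of_le (by norm_num)]
  refine IntegrableOn.of_bound (C := m ^ 2 * M) (by simp) ?_ ?_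
  · refine AEMeasurable.aestronglyMeasurable ?_
    have hd' : Measurable fun x => |deriv (sliceVol Ω) x| := by
      simpa only [Real.norm_eq_abs] using hderiv.norm
    exact ((hd'.pow_const 2).aemeasurable.div hmeas.aemeasurable).mul
      (hax.pow_const 2).aemeasurable
  · refine (ae_restrict_iff' measurableSet_Ioc).2 (Eventually.of_forall fun x hx => ?_)
    rw [Real.norm_of_nonneg (integrand_nonneg x)]
    exact (hΩ.integrand_le hne hd1 hx).trans (by gcongr; exact hM x)

/-- A Cauchy–Schwarz estimate in additive form with free parameter `L`. The Lipschitz bound away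
from the ends gives absolute continuity, hence the fundamental theorem of calculus. -/
theorem sliceVol_sub_le_integral (hΩ : IsAxisBody Ω d) (hne : (interior Ω).Nonempty)
    (hd1 : 19 / 10 ≤ d) {M : ℝ} (hM : ∀ t, sliceVol Ω t ≤ M) {x y L : ℝ} (hL : 0 < L) (hx : 0 < x)
    (hxy : x ≤ y) (hy : y ≤ 1 / 10) :
    sliceVol Ω y - sliceVol Ω x ≤ L * (∫ t in (0 : ℝ)..(1 / 10),
      |deriv (sliceVol Ω) t| ^ 2 / sliceVol Ω t * axisNorm d t ^ 2) + M / (4 * L * x) := by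
  have hM0 : 0 ≤ M := (sliceVol_nonneg 0).trans (hM 0)
  have hy0 : 0 < y := hx.trans_le hxy
  set g : ℝ → ℝ := fun t => |deriv (sliceVol Ω) t| ^ 2 / sliceVol Ω t * axisNorm d t ^ 2 with hg
  have hgint : IntervalIntegrable g volume 0 (1 / 10) :=
    hΩ.intervalIntegrable_integrand hne hd1 hM
  have hgxy : IntervalIntegrable g volume x y := by
    refine hgint.mono_set ?_
    rw [uIcc_of_le hxy, uIcc_of_le (by norm_num)]
    exact Icc_subset_Icc hx.le hy
  obtain ⟨K, hK⟩ := hΩ.lipschitzOnWith_sliceVol hx (show y < d by linarith) hM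
  rw [← uIcc_of_le hxy] at hK
  have hac := hK.absolutelyContinuousOnInterval
  have h0 : (0 : ℝ) ∉ uIcc x y := by
    rw [uIcc_of_le hxy]
    exact fun h => absurd h.1 (not_le.2 hx)
  have hzint : IntervalIntegrable (fun t : ℝ => M / (4 * L) * t ^ (-2 : ℤ)) volume x y :=
    (intervalIntegral.intervalIntegrable_zpow (Or.inr h0)).const_mul _
  have hz : ∫ t in x..y, M / (4 * L) * t ^ (-2 : ℤ) = M / (4 * L) * (x⁻¹ - y⁻¹) := by
    rw [intervalIntegral.integral_const_mul, integral_zpow (Or.inr ⟨by norm_num, h0⟩)]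
    norm_num
    left
    ring
  have hle : ∫ t in x..y, deriv (sliceVol Ω) t
      ≤ ∫ t in x..y, (L * g t + M / (4 * L) * t ^ (-2 : ℤ)) := by
    refine intervalIntegral.integral_mono_on hxy hac.intervalIntegrable_deriv
      ((hgxy.const_mul L).add hzint) fun t ht => ?_
    have ht0 : 0 < t := hx.trans_le ht.1
    have hpos := hΩ.sliceVol_pos hne (x := t) ⟨ht0, by linarith [ht.2]⟩
    have hgt : g t = deriv (sliceVol Ω) t ^ 2 / sliceVol Ω t * t ^ 2 := by
      simp only [hg, sq_abs, axisNorm]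
      rw [min_eq_left (by linarith [ht.2])]
    have h1 : sliceVol Ω t / (4 * L) * t ^ (-2 : ℤ) ≤ M / (4 * L) * t ^ (-2 : ℤ) := by
      have := hM t
      gcongr
    refine le_trans ?_ (add_le_add_right h1 _)
    -- Completing the square yields the pointwise AM–GM inequality.
    have h2 : L * g t + sliceVol Ω t / (4 * L) * t ^ (-2 : ℤ) - deriv (sliceVol Ω) t
        = (2 * L * t ^ 2 * deriv (sliceVol Ω) t - sliceVol Ω t) ^ 2
          / (4 * L * t ^ 2 * sliceVol Ω t) := by
      rw [hgt, zpow_neg, zpow_ofNat]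
      field_simp
      ring
    have h3 : 0 ≤ (2 * L * t ^ 2 * deriv (sliceVol Ω) t - sliceVol Ω t) ^ 2
          / (4 * L * t ^ 2 * sliceVol Ω t) := by positivity
    linarith
  rw [hac.integral_deriv_eq_sub, intervalIntegral.integral_add (hgxy.const_mul L) hzint,
    intervalIntegral.integral_const_mul, hz] at hle
  have hmono : ∫ t in x..y, g t ≤ ∫ t in (0 : ℝ)..(1 / 10), g t :=
    intervalIntegral.integral_mono_interval hx.le hxy hy
      (Eventually.of_forall fun t => integrand_nonneg t) hgint
  have h5 : M / (4 * L) * (x⁻¹ - y⁻¹) ≤ M / (4 * L * x) := by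
    have h6 : 0 ≤ M / (4 * L) * y⁻¹ := by positivity
    have h7 : M / (4 * L) * x⁻¹ = M / (4 * L * x) := by rw [← div_eq_mul_inv, div_div]
    rw [mul_sub]
    linarith
  have := mul_le_mul_of_nonneg_left hmono hL.le
  linarith

/-! ### Choice of scales and conclusion. -/

theorem main_estimate (hΩ : IsAxisBody Ω d) (hne : (interior Ω).Nonempty)
    (hdist : ∀ p ∈ Ω, ∀ q ∈ Ω, dist p q ≤ 2) (hd2 : d ≤ 2) (hε : 0 < maxSliceDiam Ω d)
    (hd : 2 - ((10 : ℝ) ^ (6 * (m + 1)))⁻¹ * maxSliceDiam Ω d ^ 2 ≤ d) :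
    ((10 : ℝ) ^ (6 * (m + 1)))⁻¹ / (8 * 40 ^ m * 40 ^ m) * volume.real Ω * maxSliceDiam Ω d ^ 2 ≤
      ∫ x in (0 : ℝ)..(1 / 10),
        |deriv (sliceVol Ω) x| ^ 2 / sliceVol Ω x * axisNorm d x ^ 2 := by
  set ε := maxSliceDiam Ω d with hεdef
  have hε2 : ε ≤ 2 := maxSliceDiam_le hdist
  set r : ℝ := ((10 : ℝ) ^ (3 * (m + 1)))⁻¹ * ε with hrdef
  have hr : 0 < r := by positivity
  have hr2 : ((10 : ℝ) ^ (6 * (m + 1)))⁻¹ * ε ^ 2 = r ^ 2 := by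
    rw [hrdef, mul_pow, inv_pow, ← pow_mul]
    ring_nf
  -- `350 = 7 · 50`: this makes `2 ^ (m + 1)` times the thin diameter `7r` smaller than the wide one
  -- `ε / 50`.
  have hpow : (350 : ℝ) * 2 ^ (m + 1) < 10 ^ (3 * (m + 1)) := by
    have h1 : (350 : ℝ) < 500 ^ (m + 1) := by
      have : (500 : ℝ) ^ 1 ≤ 500 ^ (m + 1) := pow_le_pow_right₀ (by norm_num) (by lia)
      linarith
    calc (350 : ℝ) * 2 ^ (m + 1) < 500 ^ (m + 1) * 2 ^ (m + 1) := by gcongr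
      _ = 10 ^ (3 * (m + 1)) := by rw [← mul_pow, pow_mul]; norm_num
  have hrε : 350 * 2 ^ (m + 1) * r < ε := by
    have h1 := mul_lt_mul_of_pos_right hpow hr
    have h2 : (10 : ℝ) ^ (3 * (m + 1)) * r = ε := by
      rw [hrdef, mul_inv_cancel_left₀ (by positivity)]
    linarith
  have hr1 : r ≤ 1 / 100 := by
    have h1 : (1 : ℝ) ≤ 2 ^ (m + 1) := one_le_pow₀ (by norm_num)
    nlinarith
  rw [hr2] at hd
  have hr3 : r ^ 2 ≤ (1 / 100) ^ 2 := pow_le_pow_left₀ hr.le hr1 2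
  have hd1 : 19 / 10 ≤ d := by linarith
  obtain ⟨b, hb, b', hb', hbb⟩ := hΩ.exists_dist_slice hd1 hd2 hε
  -- With `2 ^ (m + 1)` copies, the loss `2 ^ m` from halving still leaves a factor `2`.
  have hdouble := hΩ.mul_sliceVol_le_midpoint (N := 2 ^ (m + 1))
    (hΩ.dist_le_of_mem_slice hdist hr (by linarith) hd) hb hb' (by push_cast; linarith)
  set y : ℝ := (r ^ 2 + 1 / 10) / 2 with hy
  have hr2pos : 0 < r ^ 2 := pow_pos hr 2
  have hhalf : 2 * sliceVol Ω (r ^ 2) ≤ sliceVol Ω y := by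
    rw [Nat.cast_pow, Nat.cast_ofNat, pow_succ, mul_assoc] at hdouble
    exact le_of_mul_le_mul_left hdouble (by positivity)
  have hM := hΩ.sliceVol_le_of_mem_Icc (y := y) (by linarith) hd2 (by linarith) (by linarith)
  have hV := hΩ.volume_le (by linarith) hM
  -- This `L` makes the error term exactly `h y / 4`, half of the guaranteed growth.
  have hL : (0 : ℝ) < 40 ^ m / r ^ 2 := by positivity
  have hmain := hΩ.sliceVol_sub_le_integral hne hd1 hM (x := r ^ 2) (y := y) hL hr2pos
    (by linarith) (by linarith)
  set I := ∫ x in (0 : ℝ)..(1 / 10),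
        |deriv (sliceVol Ω) x| ^ 2 / sliceVol Ω x * axisNorm d x ^ 2
  have he : 40 ^ m * sliceVol Ω y / (4 * (40 ^ m / r ^ 2) * r ^ 2) = sliceVol Ω y / 4 := by
    field_simp
  rw [he] at hmain
  have h1 : sliceVol Ω y / 4 ≤ 40 ^ m / r ^ 2 * I := by linarith
  rw [div_mul_eq_mul_div, le_div_iff₀ hr2pos] at h1
  have h2 : volume.real Ω ≤ 2 * (40 ^ m * sliceVol Ω y) :=
    hV.trans (mul_le_mul_of_nonneg_right hd2 (by have := sliceVol_nonneg (Ω := Ω) y; positivity))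
  have h3 : ((10 : ℝ) ^ (6 * (m + 1)))⁻¹ / (8 * 40 ^ m * 40 ^ m) * volume.real Ω * ε ^ 2
      = r ^ 2 * volume.real Ω / (8 * 40 ^ m * 40 ^ m) := by
    rw [← hr2]
    ring
  rw [h3, div_le_iff₀ (by positivity)]
  have h4 := mul_le_mul_of_nonneg_left h2 hr2pos.le
  have h5 := mul_le_mul_of_nonneg_left h1 (show (0 : ℝ) ≤ 8 * 40 ^ m by positivity)
  linarith

end IsAxisBody
end ConvexAxis

theorem mainTheorem3 (m : ℕ) :
    ∃ C : ℝ, 0 < C ∧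
      ∀ (Ω : Set (EuclideanSpace ℝ (Fin (m + 1)))) (d : ℝ),
        Convex ℝ Ω → (interior Ω).Nonempty →
        ConvexAxis.IsNormalized Ω d → ConvexAxis.IsWDiameter Ω d →
        2 - ((10 : ℝ) ^ (6 * (m + 1)))⁻¹ * ConvexAxis.maxSliceDiam Ω d ^ 2 ≤ d →
        IntervalIntegrable
          (fun x : ℝ => |deriv (ConvexAxis.sliceVol Ω) x| ^ 2 / ConvexAxis.sliceVol Ω x
            * ConvexAxis.axisNorm d x ^ 2) MeasureTheory.volume 0 (1 / 10) ∧
        C * MeasureTheory.volume.real Ω * ConvexAxis.maxSliceDiam Ω d ^ 2 ≤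
          ∫ x in (0 : ℝ)..(1 / 10),
            |deriv (ConvexAxis.sliceVol Ω) x| ^ 2 / ConvexAxis.sliceVol Ω x
              * ConvexAxis.axisNorm d x ^ 2 := by
  refine ⟨((10 : ℝ) ^ (6 * (m + 1)))⁻¹ / (8 * 40 ^ m * 40 ^ m), by positivity, ?_⟩
  intro Ω d hconv hne hnorm _ hd
  -- `Metric.diam` is `0` on unbounded sets, so diameter `2` forces boundedness.
  have hbdd : Bornology.IsBounded Ω := by
    by_contra h
    have := hnorm.diam_eq
    rw [Metric.diam_eq_zero_of_unbounded h] at this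
    norm_num at this
  have hdist : ∀ p ∈ Ω, ∀ q ∈ Ω, dist p q ≤ 2 := fun p hp q hq =>
    hnorm.diam_eq ▸ Metric.dist_le_diam_of_mem hbdd hp hq
  have hΩ : ConvexAxis.IsAxisBody Ω d := ⟨hconv, hbdd, hnorm.isGLB, hnorm.isLUB⟩
  have hε2 := ConvexAxis.IsAxisBody.maxSliceDiam_le (d := d) hdist
  have hε0 : 0 ≤ ConvexAxis.maxSliceDiam Ω d := by
    refine Real.sSup_nonneg ?_
    rintro _ ⟨t, -, rfl⟩
    exact Metric.diam_nonneg
  have hd2 : d ≤ 2 := by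
    refine le_of_forall_pos_lt_add fun η hη => ?_
    obtain ⟨a, ha0, ha1, y, hy⟩ := hΩ.exists_left (half_pos hη)
    obtain ⟨b, hb0, hb1, z, hz⟩ := hΩ.exists_right (half_pos hη)
    have h1 := hdist _ (ConvexAxis.mem_slice.1 hz) _ (ConvexAxis.mem_slice.1 hy)
    have h2 := ConvexAxis.dist_axisPoint_sq b a z y
    have h3 : b - a ≤ 2 := by
      refine le_trans (abs_le_of_sq_le_sq' ?_ dist_nonneg).2 h1
      rw [h2]
      exact le_add_of_nonneg_right (sq_nonneg _)
    linarith
  have hd1 : 19 / 10 ≤ d := by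
    have h1 : ((10 : ℝ) ^ (6 * (m + 1)))⁻¹ ≤ 1 / 1000 := by
      rw [one_div]
      refine inv_anti₀ (by norm_num) ?_
      calc (1000 : ℝ) ≤ 10 ^ 6 := by norm_num
        _ ≤ 10 ^ (6 * (m + 1)) := pow_le_pow_right₀ (by norm_num) (by lia)
    have h2 : ConvexAxis.maxSliceDiam Ω d ^ 2 ≤ 2 ^ 2 := pow_le_pow_left₀ hε0 hε2 2
    have h3 := mul_le_mul h1 h2 (sq_nonneg _) (by norm_num)
    linarith
  have hM := hΩ.sliceVol_le_of_mem_Icc (y := 1 / 10) (by linarith) hd2 (by norm_num) le_rfl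
  refine ⟨hΩ.intervalIntegrable_integrand hne hd1 hM, ?_⟩
  -- When all slices have diameter `0` (as for `m = 0`) the scale `r` degenerates, but the lower
  -- bound is then `0`.
  rcases hε0.eq_or_lt with h | h
  · rw [← h, zero_pow two_ne_zero, mul_zero]
    exact intervalIntegral.integral_nonneg (by norm_num) fun x _ =>
      ConvexAxis.IsAxisBody.integrand_nonneg x
  · exact hΩ.main_estimate hne hdist hd2 h hd
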